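/- Let $d\ge 1$, let $r_0>0$, and let $D\subset\mathbb R^d$ be a nonempty compact set. For $A\subset\mathbb R^d$ let $d_A(x)=\inf_{y\in A}\|x-y\|$ be the Euclidean distance function, let $U_h(A)=\{x\in\mathbb R^d : d_A(x)\le h\}$, and let $$\operatorname{Reach}(A)=\sup\{h>0 : d_A \text{ is differentiable in } U_h(A)\setminus A\}\in[0,\infty]$$ (with $\sup\emptyset=0$). Let $\mathcal H^k$ denote the $k$-dimensional Hausdorff measure, and let $$\mathscr O_{r_0}=\{\Omega\subset D : \Omega \text{ is closed},\ \operatorname{Reach}(\partial\Omega)\ge r_0,\ \Omega\neq\emptyset,\ \mathcal H^d(\partial\Omega)=0\},$$ where $\partial\Omega$ is the topological boundary of $\Omega$. Then there exists a constant $C<\infty$, depending only on $d$, $r_0$ and $D$, such that $\mathcal H^{d-1}(\partial\Omega)\le C$ for every $\Omega\in\mathscr O_{r_0}$. -/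

import Mathlib

open scoped MeasureTheory ENNReal NNReal

/-- The closed tubular neighbourhood `U_h(A) = {x | d_A(x) ≤ h}`, where `d_A` is the Euclidean
distance function to `A`. -/
def tubularNhd {d : ℕ} (h : ℝ) (A : Set (EuclideanSpace ℝ (Fin d))) :
    Set (EuclideanSpace ℝ (Fin d)) :=
  {x | Metric.infDist x A ≤ h}

/-- The reach of `A`: the supremum in `[0, ∞]` of all `h > 0` such that the distance function `d_A`
is differentiable (as a function on the whole space) at every point of `U_h(A) \ A`. -/
noncomputable def reach {d : ℕ} (A : Set (EuclideanSpace ℝ (Fin d))) : ℝ≥0∞ :=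
  sSup {r : ℝ≥0∞ | ∃ h : ℝ, 0 < h ∧ r = ENNReal.ofReal h ∧
    ∀ x ∈ tubularNhd h A \ A, DifferentiableAt ℝ (fun y => Metric.infDist y A) x}

/-- The class `𝒪_{r₀}` of admissible shapes contained in `D`. Here `frontier Ω` is the topological
boundary `∂Ω` and `μHE[d]` is the `d`-dimensional Hausdorff measure, normalised so that it is
Lebesgue measure on `d`-dimensional Euclidean space. -/
def admissibleShapes {d : ℕ} (D : Set (EuclideanSpace ℝ (Fin d))) (r₀ : ℝ) :
    Set (Set (EuclideanSpace ℝ (Fin d))) :=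
  {Ω | Ω ⊆ D ∧ IsClosed Ω ∧ ENNReal.ofReal r₀ ≤ reach (frontier Ω) ∧ Ω.Nonempty ∧
    μHE[d] (frontier Ω) = 0}

/-! Positive reach yields an exterior ball condition: differentiability makes the distance to `∂Ω`
increase at unit speed away from a nearest point, so points off `∂Ω` can be pushed out to distance
`h = r₀ / 2` almost optimally. As `∂Ω` is null, its complement is dense, and a limit gives every
boundary point a touching ball of radius `h` that contains no boundary point in its interior.
Boundary points that are close together and have nearly parallel ball directions then form a
Lipschitz graph over a hyperplane. Compactness of `D` and of the unit sphere bounds the number of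
such pieces, and each has controlled measure. -/

/-- At a point outside a compact set `A` where the distance to `A` is differentiable, the distance
grows with unit speed in some direction. -/
theorem exists_hasDerivAt_infDist_one {V : Type*} [NormedAddCommGroup V] [NormedSpace ℝ V]
    {A : Set V} (hA : IsCompact A) (hne : A.Nonempty) {x : V} (hx : 0 < Metric.infDist x A)
    (hdiff : DifferentiableAt ℝ (fun y => Metric.infDist y A) x) :
    ∃ v : V, ‖v‖ = 1 ∧ HasDerivAt (fun s : ℝ => Metric.infDist (x + s • v) A) 1 0 := by
  obtain ⟨p, hpA, hp⟩ := hA.exists_infDist_eq_dist hne x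
  set r := Metric.infDist x A with hr
  rw [dist_eq_norm] at hp
  set v : V := r⁻¹ • (x - p) with hv
  have hv1 : ‖v‖ = 1 := by
    rw [hv, norm_smul, ← hp, Real.norm_of_nonneg (by positivity), inv_mul_cancel₀ hx.ne']
  have hrv : x - p = r • v := by rw [hv, smul_inv_smul₀ hx.ne']
  refine ⟨v, hv1, ?_⟩
  have hline : HasDerivAt (fun s : ℝ => x + s • v) v 0 := by
    simpa using ((hasDerivAt_id (0 : ℝ)).smul_const v).const_add x
  have hcomp : HasDerivAt (fun s : ℝ => Metric.infDist (x + s • v) A)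
      (fderiv ℝ (fun y => Metric.infDist y A) x v) 0 := by
    have h0 : HasFDerivAt (fun y => Metric.infDist y A)
        (fderiv ℝ (fun y => Metric.infDist y A) x) (x + (0 : ℝ) • v) := by
      simpa using hdiff.hasFDerivAt
    exact h0.comp_hasDerivAt (0 : ℝ) hline
  -- Along the segment from the nearest point `p` to `x` the distance is exactly affine, so the left
  -- derivative is 1; differentiability makes it two-sided.
  have hback : ∀ s ∈ Set.Icc (-r) 0, Metric.infDist (x + s • v) A = r + s := by
    intro s hs
    apply le_antisymm
    · refine (Metric.infDist_le_dist_of_mem hpA).trans ?_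
      rw [dist_eq_norm, show x + s • v - p = (r + s) • v by rw [add_smul, ← hrv]; abel,
        norm_smul, hv1, mul_one, Real.norm_of_nonneg (by linarith [hs.1])]
    · have h1 : r ≤ Metric.infDist (x + s • v) A + dist x (x + s • v) :=
        Metric.infDist_le_infDist_add_dist
      rw [dist_self_add_right, norm_smul, hv1, mul_one, Real.norm_of_nonpos hs.2] at h1
      linarith
  have hone : HasDerivWithinAt (fun s : ℝ => Metric.infDist (x + s • v) A) 1 (Set.Icc (-r) 0) 0 :=
    ((hasDerivAt_id (0 : ℝ)).const_add r).hasDerivWithinAt.congr hback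
      (hback 0 ⟨by linarith, le_rfl⟩)
  have huniq : UniqueDiffWithinAt ℝ (Set.Icc (-r) 0) (0 : ℝ) :=
    uniqueDiffOn_Icc (by linarith) 0 ⟨by linarith, le_rfl⟩
  rwa [huniq.eq_deriv _ hcomp.hasDerivWithinAt hone] at hcomp

/-- If the distance to a compact set `A` is differentiable at all points at distance in `(0, h]`
from `A`, then each such point can be moved to distance `h` from `A` along a path that is almost
no longer than necessary. -/
theorem exists_infDist_eq_and_dist_le {V : Type*} [NormedAddCommGroup V] [NormedSpace ℝ V]
    [ProperSpace V] {A : Set V} (hA : IsCompact A) (hne : A.Nonempty) {h : ℝ}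
    (hdiff : ∀ x, 0 < Metric.infDist x A → Metric.infDist x A ≤ h →
      DifferentiableAt ℝ (fun y => Metric.infDist y A) x)
    {y : V} (hy : 0 < Metric.infDist y A) (hyh : Metric.infDist y A ≤ h) {ε : ℝ} (hε : 0 < ε) :
    ∃ w, Metric.infDist w A = h ∧ dist w y ≤ (1 + ε) * (h - Metric.infDist y A) := by
  set R := h - Metric.infDist y A with hR
  have hR0 : 0 ≤ R := by linarith
  set g : V → ℝ := fun w => Metric.infDist w A - Metric.infDist y A with hg
  have hgc : Continuous g := (Metric.continuous_infDist_pt A).sub continuous_const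
  -- Continuous induction on the distance gained: `K` holds the points reached at cost at most `1 +
  -- ε` per unit of gain. The slack lets a derivative of 1 pay for a short step.
  set K : Set V := Metric.closedBall y ((1 + ε) * R) ∩ {w | dist w y ≤ (1 + ε) * g w} with hK
  have hKc : IsCompact K := (isCompact_closedBall _ _).inter_right
    (isClosed_le (by fun_prop) (by fun_prop))
  have hclosed : IsClosed (g '' K ∩ Set.Icc 0 R) := (hKc.image hgc).isClosed.inter isClosed_Icc
  have hzero : (0 : ℝ) ∈ g '' K := by
    refine ⟨y, ⟨?_, ?_⟩, by simp [hg]⟩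
    · simp only [Metric.mem_closedBall, dist_self]; positivity
    · simp [hg]
  have hstep : ∀ ρ ∈ g '' K ∩ Set.Ico 0 R, ∀ z ∈ Set.Ioi ρ, (g '' K ∩ Set.Ioc ρ z).Nonempty := by
    rintro _ ⟨⟨w, ⟨-, hw⟩, rfl⟩, hw0, hwR⟩ z hz
    simp only [Set.mem_ofPred_eq, Set.mem_Ioi] at hw hz
    have hwd : Metric.infDist w A = g w + Metric.infDist y A := by simp [hg]
    obtain ⟨v, hv, hder⟩ := exists_hasDerivAt_infDist_one hA hne (x := w) (by linarith)
      (hdiff w (by linarith) (by linarith))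
    have hlt : (1 + ε)⁻¹ < 1 := inv_lt_one_of_one_lt₀ (by linarith)
    have hslope := ((hasDerivWithinAt_iff_tendsto_slope'
      Set.self_notMem_Ioi).1 (hder.hasDerivWithinAt (s := Set.Ioi 0))).eventually (lt_mem_nhds hlt)
    have hsmall : ∀ᶠ s : ℝ in nhdsWithin 0 (Set.Ioi 0), s ∈ Set.Ioc 0 (min z R - g w) :=
      Ioc_mem_nhdsGT (by simpa using ⟨hz, hwR⟩)
    obtain ⟨s, hs1, hs0, hs⟩ := (hslope.and hsmall).exists
    have hsz : s ≤ z - g w := hs.trans (by gcongr; exact min_le_left _ _)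
    have hsR : s ≤ R - g w := hs.trans (by gcongr; exact min_le_right _ _)
    rw [slope_def_field, zero_smul, add_zero, sub_zero, lt_div_iff₀ hs0] at hs1
    have hgs : g (w + s • v) - g w = Metric.infDist (w + s • v) A - Metric.infDist w A := by
      simp [hg]
    have hdist : dist (w + s • v) w = s := by
      rw [dist_self_add_left, norm_smul, hv, mul_one, Real.norm_of_nonneg hs0.le]
    have hup : Metric.infDist (w + s • v) A ≤ Metric.infDist w A + s := by
      simpa [hdist] using Metric.infDist_le_infDist_add_dist (s := A) (x := w + s • v) (y := w)
    have hgain : s ≤ (1 + ε) * (g (w + s • v) - g w) := by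
      rw [hgs]
      rw [inv_mul_lt_iff₀ (by linarith)] at hs1
      exact hs1.le
    have hpos : 0 < g (w + s • v) - g w := by
      rw [hgs]; exact lt_trans (by positivity) hs1
    have hnear : dist (w + s • v) y ≤ (1 + ε) * g (w + s • v) := by
      calc dist (w + s • v) y ≤ dist (w + s • v) w + dist w y := dist_triangle _ _ _
        _ ≤ (1 + ε) * (g (w + s • v) - g w) + (1 + ε) * g w := by rw [hdist]; gcongr
        _ = _ := by ring
    refine ⟨g (w + s • v), ⟨w + s • v, ⟨?_, hnear⟩, rfl⟩, by linarith, by linarith⟩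
    refine hnear.trans ?_
    gcongr
    linarith
  obtain ⟨w, ⟨hw, -⟩, hwR⟩ :=
    hclosed.Icc_subset_of_forall_exists_gt hzero hstep (Set.right_mem_Icc.2 hR0)
  refine ⟨w, ?_, hw⟩
  simp only [hg, hR] at hwR
  linarith

/-- A compact set with empty interior whose distance function is differentiable at all points at
distance in `(0, h]` satisfies the exterior ball condition with radius `h` at each of its points. -/
theorem exists_dist_le_and_le_infDist {V : Type*} [NormedAddCommGroup V] [NormedSpace ℝ V]
    [ProperSpace V] {A : Set V} (hA : IsCompact A) (hne : A.Nonempty) (hd : Dense Aᶜ)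
    {h : ℝ} (hh : 0 < h)
    (hdiff : ∀ x, 0 < Metric.infDist x A → Metric.infDist x A ≤ h →
      DifferentiableAt ℝ (fun y => Metric.infDist y A) x) {x : V} (hx : x ∈ A) :
    ∃ z, dist x z ≤ h ∧ h ≤ Metric.infDist z A := by
  set E : Set V := {w | h ≤ Metric.infDist w A} with hE
  have hEc : IsClosed E := isClosed_le continuous_const (Metric.continuous_infDist_pt A)
  set U : Set V := {y | Metric.infDist y A < h} with hU
  have hUo : IsOpen U := isOpen_lt (Metric.continuous_infDist_pt A) continuous_const
  have hxU : x ∈ U := by simpa [hU, Metric.infDist_zero_of_mem hx] using hh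
  have hmove : ∀ y ∈ U ∩ Aᶜ, ∀ ε > 0, ∃ w ∈ E, dist w y ≤ (1 + ε) * h := by
    intro y hy ε hε
    have hy0 : 0 < Metric.infDist y A := (hA.isClosed.notMem_iff_infDist_pos hne).1 hy.2
    obtain ⟨w, hw, hwy⟩ := exists_infDist_eq_and_dist_le hA hne hdiff hy0 (le_of_lt hy.1) hε
    exact ⟨w, hw.ge, hwy.trans (by gcongr; linarith)⟩
  -- Points off `A` accumulate at `x`, and the bound on the distance to `E` is a closed condition.
  have hxcl : x ∈ closure (U ∩ Aᶜ) := hd.open_subset_closure_inter hUo hxU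
  have hle : ∀ y ∈ U ∩ Aᶜ, Metric.infDist y E ≤ h := by
    intro y hy
    refine le_of_forall_pos_le_add fun δ hδ => ?_
    obtain ⟨w, hwE, hw⟩ := hmove y hy (δ / h) (by positivity)
    refine (Metric.infDist_le_dist_of_mem hwE).trans ?_
    rw [dist_comm]
    refine hw.trans (le_of_eq ?_)
    field_simp
  have hxE : Metric.infDist x E ≤ h :=
    closure_minimal hle (isClosed_le (Metric.continuous_infDist_pt E) continuous_const) hxcl
  obtain ⟨y, hy⟩ : (U ∩ Aᶜ).Nonempty := closure_nonempty_iff.1 ⟨x, hxcl⟩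
  obtain ⟨w, hwE, -⟩ := hmove y hy 1 one_pos
  obtain ⟨z, hzE, hz⟩ := hEc.exists_infDist_eq_dist ⟨w, hwE⟩ x
  exact ⟨z, hz ▸ hxE, hzE⟩

open scoped RealInnerProductSpace in
/-- A set with small slopes in the direction of a unit vector `e` is controlled in codimension one
by its projection to the hyperplane orthogonal to `e`. -/
theorem hausdorffMeasure_le_of_abs_inner_le {V : Type*} [NormedAddCommGroup V]
    [InnerProductSpace ℝ V] [MeasurableSpace V] [BorelSpace V] {e : V} (he : ‖e‖ = 1)
    {P B : Set V} (hPB : P ⊆ B)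
    (hP : ∀ x ∈ P, ∀ y ∈ P, |⟪e, y - x⟫| ≤ 1 / 2 * ‖y - x‖) (k : ℕ) :
    μH[k] P ≤ 2 ^ k * μH[k] ((ℝ ∙ e)ᗮ.orthogonalProjectionOnto '' B) := by
  set f := (ℝ ∙ e)ᗮ.orthogonalProjectionOnto with hf
  -- By Pythagoras the projection keeps at least `√3 / 2 ≥ 1 / 2` of each length.
  have hanti : AntilipschitzWith 2 (P.domRestrict f) := by
    refine AntilipschitzWith.of_le_mul_dist fun x y => ?_
    have hsq := Submodule.norm_sq_eq_add_norm_sq_projection (x.1 - y.1) (ℝ ∙ e)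
    have hin := hP y.1 y.2 x.1 x.2
    have hproj : ‖(ℝ ∙ e).orthogonalProjectionOnto (x.1 - y.1)‖ = |⟪e, x.1 - y.1⟫| := by
      rw [← Submodule.norm_coe, ← Submodule.starProjection_apply,
        Submodule.starProjection_unit_singleton ℝ he, norm_smul, he, mul_one, Real.norm_eq_abs]
    rw [hproj] at hsq
    rw [Subtype.dist_eq, dist_eq_norm, dist_eq_norm, Set.domRestrict_apply, Set.domRestrict_apply,
      ← map_sub]
    refine abs_le_of_sq_le_sq' ?_ (by positivity) |>.2
    have := pow_le_pow_left₀ (abs_nonneg _) hin 2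
    push_cast
    nlinarith [sq_nonneg ‖f (x.1 - y.1)‖, sq_nonneg ‖x.1 - y.1‖]
  calc μH[k] P = μH[k] (Subtype.val '' (Set.univ : Set P)) := by simp
    _ = μH[k] (Set.univ : Set P) :=
      isometry_subtype_coe.hausdorffMeasure_image (Or.inl (by positivity)) _
    _ ≤ ((2 : ℝ≥0) : ℝ≥0∞) ^ (k : ℝ) * μH[k] (P.domRestrict f '' Set.univ) :=
      hanti.le_hausdorffMeasure_image (by positivity) _
    _ ≤ 2 ^ k * μH[k] (f '' B) := by
      rw [ENNReal.rpow_natCast]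
      gcongr
      · simp
      · rw [Set.image_univ, Set.range_domRestrict]
        exact Set.image_mono hPB

open scoped RealInnerProductSpace in
/-- The exterior ball condition bounds the slopes of a set at small scales, in all directions close
to the directions of the centres of the balls. -/
theorem abs_inner_le_of_exterior_ball {V : Type*} [NormedAddCommGroup V] [InnerProductSpace ℝ V]
    {h : ℝ} (hh : 0 < h) {e x y z w : V} (hxz : dist x z = h) (hyw : dist y w = h)
    (hyz : h ≤ dist y z) (hxw : h ≤ dist x w) (hze : ‖h⁻¹ • (z - x) - e‖ ≤ 1 / 4)
    (hwe : ‖h⁻¹ • (w - y) - e‖ ≤ 1 / 4) (hxy : dist x y ≤ h / 2) :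
    |⟪e, y - x⟫| ≤ 1 / 2 * ‖y - x‖ := by
  have key : ∀ {a b c : V}, dist a c = h → h ≤ dist b c → ‖h⁻¹ • (c - a) - e‖ ≤ 1 / 4 →
      dist a b ≤ h / 2 → ⟪e, b - a⟫ ≤ 1 / 2 * ‖b - a‖ := by
    intro a b c hac hbc hce hab
    rw [dist_comm, dist_eq_norm] at hac hab
    rw [dist_eq_norm] at hbc
    have hexp := norm_sub_sq_real (b - a) (c - a)
    rw [sub_sub_sub_cancel_right, hac] at hexp
    -- Since `b` lies outside the ball about `c` whose sphere contains `a`, its normal component is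
    -- quadratically small; `‖b - a‖ ≤ h / 2` turns this into slope `1 / 4`, and the tilt of `e`
    -- costs another `1 / 4`.
    have h1 : 2 * ⟪b - a, c - a⟫ ≤ ‖b - a‖ ^ 2 := by nlinarith
    have h2 : ⟪h⁻¹ • (c - a), b - a⟫ ≤ 1 / 4 * ‖b - a‖ := by
      rw [real_inner_smul_left, real_inner_comm, inv_mul_le_iff₀ hh]
      nlinarith [norm_nonneg (b - a)]
    have h3 : -⟪h⁻¹ • (c - a) - e, b - a⟫ ≤ 1 / 4 * ‖b - a‖ :=
      (neg_le_abs _).trans ((abs_real_inner_le_norm _ _).trans (by gcongr))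
    rw [inner_sub_left] at h3
    linarith
  have h1 := key hxz hyz hze hxy
  have h2 := key hyw hxw hwe (by rwa [dist_comm])
  rw [← neg_sub y x, inner_neg_right, norm_neg] at h2
  exact abs_le.2 ⟨by linarith, h1⟩

open MeasureTheory in
/-- Subsets of a fixed compact set which satisfy the exterior ball condition with a fixed radius
have uniformly bounded Hausdorff measure of codimension one. -/
theorem exists_euclideanHausdorffMeasure_le_of_exterior_ball {V : Type*} [NormedAddCommGroup V]
    [InnerProductSpace ℝ V] [FiniteDimensional ℝ V] [MeasurableSpace V] [BorelSpace V]
    {D : Set V} (hD : IsCompact D) {h : ℝ} (hh : 0 < h) {k : ℕ}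
    (hk : Module.finrank ℝ V = k + 1) :
    ∃ C : ℝ≥0, ∀ A ⊆ D, (∀ x ∈ A, ∃ z, dist x z = h ∧ ∀ y ∈ A, h ≤ dist y z) →
      μHE[k] A ≤ (C : ℝ≥0∞) := by
  obtain ⟨T, hTs, hTf, hT⟩ := (isCompact_sphere (0 : V) 1).finite_cover_balls
    (show (0 : ℝ) < 1 / 4 by norm_num)
  obtain ⟨S, -, hSf, hS⟩ := hD.finite_cover_balls (show (0 : ℝ) < h / 4 by positivity)
  set c : ℝ≥0 := Measure.addHaarScalarFactor (volume : Measure (EuclideanSpace ℝ (Fin k))) μH[k]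
  set M : V × V → ℝ≥0∞ := fun q =>
    2 ^ k * μHE[k] ((ℝ ∙ q.1)ᗮ.orthogonalProjectionOnto '' Metric.ball q.2 (h / 4)) with hM
  have hMfin : ∀ q ∈ T ×ˢ S, M q < ⊤ := by
    intro q hq
    have he : ‖q.1‖ = 1 := by simpa using hTs hq.1
    have hfact : Fact (Module.finrank ℝ V = k + 1) := ⟨hk⟩
    have hrank : Module.finrank ℝ (ℝ ∙ q.1)ᗮ = k :=
      Submodule.finrank_orthogonal_span_singleton (norm_ne_zero_iff.1 (by rw [he]; norm_num))
    refine ENNReal.mul_lt_top (by simp) ?_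
    have hb : Bornology.IsBounded
        ((ℝ ∙ q.1)ᗮ.orthogonalProjectionOnto '' Metric.ball q.2 (h / 4)) :=
      ((ℝ ∙ q.1)ᗮ.orthogonalProjectionOnto.lipschitz).isBounded_image Metric.isBounded_ball
    have hlt := hb.measure_lt_top (μ := μHE[Module.finrank ℝ (ℝ ∙ q.1)ᗮ])
    rwa [hrank] at hlt
  have hTS : (T ×ˢ S).Finite := hTf.prod hSf
  have hsum : ∑ q ∈ hTS.toFinset, M q < ⊤ :=
    ENNReal.sum_lt_top.2 fun q hq => hMfin q (hTS.mem_toFinset.1 hq)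
  refine ⟨(∑ q ∈ hTS.toFinset, M q).toNNReal, fun A hAD hA => ?_⟩
  rw [ENNReal.coe_toNNReal hsum.ne]
  choose! z hz hAz using hA
  -- Radius `h / 4` in position makes any two points of a piece at most `h / 2` apart.
  set P : V × V → Set V := fun q =>
    {x ∈ A | h⁻¹ • (z x - x) ∈ Metric.ball q.1 (1 / 4) ∧ x ∈ Metric.ball q.2 (h / 4)} with hP
  have hcover : A ⊆ ⋃ q ∈ hTS.toFinset, P q := by
    intro x hx
    have hn : h⁻¹ • (z x - x) ∈ Metric.sphere (0 : V) 1 := by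
      rw [mem_sphere_zero_iff_norm, norm_smul, ← dist_eq_norm, dist_comm, hz x hx,
        Real.norm_of_nonneg (by positivity), inv_mul_cancel₀ hh.ne']
    obtain ⟨e, heT, he⟩ := Set.mem_iUnion₂.1 (hT hn)
    obtain ⟨s, hsS, hs⟩ := Set.mem_iUnion₂.1 (hS (hAD hx))
    exact Set.mem_iUnion₂.2 ⟨(e, s), hTS.mem_toFinset.2 ⟨heT, hsS⟩, hx, he, hs⟩
  refine (measure_mono hcover).trans ((measure_biUnion_finset_le _ _).trans ?_)
  refine Finset.sum_le_sum fun q hq => ?_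
  have hq' := hTS.mem_toFinset.1 hq
  have he : ‖q.1‖ = 1 := by simpa using hTs hq'.1
  have hle := hausdorffMeasure_le_of_abs_inner_le he (P := P q) (B := Metric.ball q.2 (h / 4))
    (fun x hx => hx.2.2) (fun x hx y hy => abs_inner_le_of_exterior_ball hh (hz x hx.1) (hz y hy.1)
      (hAz x hx.1 y hy.1) (hAz y hy.1 x hx.1) (mem_ball_iff_norm.1 hx.2.1).le
      (mem_ball_iff_norm.1 hy.2.1).le (by
        have h1 := dist_triangle_right x y q.2
        have h2 := Metric.mem_ball.1 hx.2.2
        have h3 := Metric.mem_ball.1 hy.2.2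
        linarith)) k
  simp only [hM, Measure.euclideanHausdorffMeasure_def, Measure.smul_apply, ENNReal.smul_def,
    smul_eq_mul]
  -- The normalising factor of `μHE[k]` depends only on `k`, so it is common to both sides.
  rw [mul_left_comm]
  gcongr

theorem mainTheorem9 (d : ℕ) (hd : 1 ≤ d) (r₀ : ℝ) (hr₀ : 0 < r₀)
    (D : Set (EuclideanSpace ℝ (Fin d))) (hD : IsCompact D) (hDne : D.Nonempty) :
    ∃ C : ℝ≥0, ∀ Ω ∈ admissibleShapes D r₀, μHE[d - 1] (frontier Ω) ≤ (C : ℝ≥0∞) := by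
  have hh : 0 < r₀ / 2 := by positivity
  obtain ⟨C, hC⟩ := exists_euclideanHausdorffMeasure_le_of_exterior_ball hD hh (k := d - 1)
    (by rw [finrank_euclideanSpace_fin]; omega)
  refine ⟨C, fun Ω ⟨hΩD, hΩc, hreach, _, hnull⟩ => ?_⟩
  have hAD : frontier Ω ⊆ D := hΩc.frontier_subset.trans hΩD
  have hA : IsCompact (frontier Ω) := hD.of_isClosed_subset isClosed_frontier hAD
  refine hC _ hAD fun x hx => ?_
  -- Halving `r₀` gives a strict inequality, so some radius in the supremum exceeds `r₀ / 2`.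
  have hlt : ENNReal.ofReal (r₀ / 2) < reach (frontier Ω) :=
    lt_of_lt_of_le ((ENNReal.ofReal_lt_ofReal_iff hr₀).2 (by linarith)) hreach
  obtain ⟨_, ⟨h, -, rfl, hdiff⟩, hr⟩ := lt_sSup_iff.1 hlt
  have hrh : r₀ / 2 < h := (ENNReal.ofReal_lt_ofReal_iff_of_nonneg hh.le).1 hr
  have hdense : Dense (frontier Ω)ᶜ := by
    rw [EuclideanSpace.euclideanHausdorffMeasure_eq_volume] at hnull
    exact interior_eq_empty_iff_dense_compl.1 (MeasureTheory.Measure.interior_eq_empty_of_null hnull)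
  obtain ⟨z, hxz, hz⟩ := exists_dist_le_and_le_infDist hA ⟨x, hx⟩ hdense hh
    (fun y hy hyh => hdiff y ⟨hyh.trans hrh.le, fun hyA => by
      rw [Metric.infDist_zero_of_mem hyA] at hy
      exact lt_irrefl _ hy⟩) hx
  have hball : ∀ y ∈ frontier Ω, r₀ / 2 ≤ dist y z := fun y hy => by
    rw [dist_comm]
    exact hz.trans (Metric.infDist_le_dist_of_mem hy)
  exact ⟨z, le_antisymm hxz (hball x hx), hball⟩
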